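/- Let $R$ be a commutative Noetherian ring, $M$ a finitely generated $R$-module, $N\subseteq M$ a submodule, and $\mathfrak p$ an embedded associated prime of $N$, i.e. $\mathfrak p\in\mathrm{Ass}_R(M/N)$ and $\mathfrak p$ is not minimal in $\mathrm{Ass}_R(M/N)$. A proper submodule of $M$ is irreducible if it is not the intersection of two strictly larger submodules; a finite decomposition of a submodule as an intersection of irreducible submodules is irredundant if no member can be omitted. An irredundant primary decomposition is a finite one in which no member can be omitted and the members belong to pairwise distinct primes. A $\mathfrak p$-maximal embedded component of $N$ is a maximal element, with respect to inclusion, of the set of all $\mathfrak p$-primary submodules of $M$ that appear in some irredundant primary decomposition of $N$. For a submodule $L$ of $M$, let $\mathrm{IC}_{\mathfrak p}(L)$ be the set of all irreducible $\mathfrak p$-primary submodules of $M$ that appear in some irredundant irreducible decomposition of $L$, and let $\mathrm{ir}_{\mathfrak p}(L)$ be the number of $\mathfrak p$-primary members of an irredundant irreducible decomposition of $L$. Let $k(\mathfrak p)=R_{\mathfrak p}/\mathfrak pR_{\mathfrak p}$, and let $\mathrm{Soc}$ denote the socle of an $R_{\mathfrak p}$-module, the sum of its simple submodules. Then for $L=N$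 and for $L$ any $\mathfrak p$-maximal embedded component of $N$, the number $\mathrm{ir}_{\mathfrak p}(L)$ does not depend on the chosen irredundant irreducible decomposition of $L$, and: (i) for every $\mathfrak p$-maximal embedded component $Q$ of $N$, $$\mathrm{ir}_{\mathfrak p}(N)=\mathrm{ir}_{\mathfrak p}(Q)=\dim_{k(\mathfrak p)}\mathrm{Soc}\big((M/N)_{\mathfrak p}\big);$$ (ii) $\mathrm{IC}_{\mathfrak p}(N)=\bigcup_Q \mathrm{IC}_{\mathfrak p}(Q)$, where $Q$ runs over all $\mathfrak p$-maximal embedded components of $N$. -/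

import Mathlib

namespace IndexOfReducibility

/-- The socle of a module: the sum of all its simple submodules. -/
def socle (A L : Type*) [CommRing A] [AddCommGroup L] [Module A L] : Submodule A L :=
  sSup {S : Submodule A L | IsSimpleModule A S}

/-- Over a local ring the maximal ideal annihilates the socle. -/
theorem socle_isTorsionBySet (A L : Type*) [CommRing A] [IsLocalRing A] [AddCommGroup L]
    [Module A L] :
    Module.IsTorsionBySet A (socle A L) (IsLocalRing.maximalIdeal A : Set A) := by
  have key : socle A L ≤ Submodule.torsionBySet A L (IsLocalRing.maximalIdeal A : Set A) := by
    refine sSup_le fun S hS x hx => ?_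
    have hS' : IsSimpleModule A S := hS
    have hmax : (Module.annihilator A S).IsMaximal := IsSimpleModule.annihilator_isMaximal
    rw [Submodule.mem_torsionBySet_iff]
    rintro ⟨a, ha⟩
    rw [← IsLocalRing.eq_maximalIdeal hmax] at ha
    exact congrArg Subtype.val (Module.mem_annihilator.mp ha ⟨x, hx⟩)
  intro x a
  exact Subtype.ext ((Submodule.mem_torsionBySet_iff _ _).mp (key x.2) a)

/-- Over a local ring the socle is a vector space over the residue field, with
`(a mod 𝔪) • x = a • x`. -/
noncomputable instance (A L : Type*) [CommRing A] [IsLocalRing A] [AddCommGroup L]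
    [Module A L] : Module (IsLocalRing.ResidueField A) (socle A L) :=
  (socle_isTorsionBySet A L).module

variable {R M : Type*} [CommRing R] [AddCommGroup M] [Module R M]

/-- `p` is an embedded associated prime of `N`: it belongs to `Ass (M / N)` and is not minimal
there. -/
def IsEmbeddedPrime (N : Submodule R M) (p : Ideal R) : Prop :=
  p ∈ associatedPrimes R (M ⧸ N) ∧ ∃ q ∈ associatedPrimes R (M ⧸ N), q < p

/-- `Q` is a `p`-primary submodule of `M`. -/
def IsPrimaryAt (p : Ideal R) (Q : Submodule R M) : Prop :=
  Q.IsPrimary ∧ (Q.colon Set.univ).radical = p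

/-- The set `⋀_p(N)` of `p`-primary components of `N`: the `p`-primary submodules which appear in
some irredundant primary decomposition of `N`. -/
def primaryComponents (p : Ideal R) (N : Submodule R M) : Set (Submodule R M) :=
  {Q | IsPrimaryAt p Q ∧ ∃ t : Finset (Submodule R M), N.IsMinimalPrimaryDecomposition t ∧ Q ∈ t}

/-- `Q` is a `p`-maximal embedded component of `N`: a maximal element, with respect to inclusion,
of the set of `p`-primary components of `N`. -/
def IsMaximalComponent (p : Ideal R) (N Q : Submodule R M) : Prop :=
  Maximal (· ∈ primaryComponents p N) Q

/-- `s` is an irredundant irreducible decomposition of `L`. -/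
structure IsIrredundantIrreducibleDecomposition (L : Submodule R M)
    (s : Finset (Submodule R M)) : Prop where
  inf_eq : s.inf id = L
  irreducible : ∀ ⦃J⦄, J ∈ s → InfIrred J
  irredundant : ∀ ⦃J⦄, J ∈ s → ¬ (s.erase J).inf id ≤ J

/-- The set `IC_p(L)` of irreducible `p`-primary submodules which appear in some irredundant
irreducible decomposition of `L`. -/
def irreducibleComponents (p : Ideal R) (L : Submodule R M) : Set (Submodule R M) :=
  {Q | IsPrimaryAt p Q ∧
    ∃ s : Finset (Submodule R M), IsIrredundantIrreducibleDecomposition L s ∧ Q ∈ s}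

/-- The number of `p`-primary members of a finite set of submodules. -/
noncomputable def countAt (p : Ideal R) (s : Finset (Submodule R M)) : ℕ :=
  {Q : Submodule R M | Q ∈ s ∧ IsPrimaryAt p Q}.ncard

/-- `ir_p(L)`: the number of `p`-primary members of an irredundant irreducible decomposition
of `L`. The infimum picks a decomposition for which this number is smallest; that the number is the
same for every decomposition is not part of the definition. -/
noncomputable def irAt (p : Ideal R) (L : Submodule R M) : ℕ :=
  sInf {n | ∃ s : Finset (Submodule R M),
    IsIrredundantIrreducibleDecomposition L s ∧ countAt p s = n}

/-- Irredundant irreducible decompositions exist, so that `irAt` is attained. -/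
theorem exists_isIrredundantIrreducibleDecomposition [IsNoetherian R M] (L : Submodule R M) :
    ∃ s, IsIrredundantIrreducibleDecomposition L s := by
  obtain ⟨s, hs, hirr⟩ := exists_infIrred_decomposition L
  obtain ⟨t, hts, ht, hmin⟩ := Submodule.decomposition_erase_inf hs
  exact ⟨t, ht, fun J hJ => hirr (hts hJ), hmin⟩

end IndexOfReducibility

/-!
For an irreducible submodule `J` the socle of `(M ⧸ J)_p` is one-dimensional over the residue field
if `J` is `p`-primary, and zero otherwise.
For an irredundant irreducible decomposition `N = ⋂ J`, irredundancy makes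
`Soc (M ⧸ N)_p → ∏ Soc (M ⧸ J)_p`, over the `p`-primary members `J`, an isomorphism, so their number
is `dim Soc (M ⧸ N)_p`.

For a `p`-primary component `Q` of `N` the map `Soc (M ⧸ N)_p → Soc (M ⧸ Q)_p` is injective. If `Q`
is the intersection of the `p`-primary members of an irredundant irreducible decomposition of `N`,
it is also surjective, so no larger component exists, since a `p`-primary submodule cannot be
enlarged without creating a kernel on socles. Conversely, given an irredundant irreducible
decomposition of a maximal component, adding one of the intersection of the other components and
discarding superfluous members gives one of `N`, and by maximality no `p`-primary member is
discarded.
-/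

namespace IndexOfReducibility

section Socle

variable {A L K : Type*} [CommRing A] [IsLocalRing A] [AddCommGroup L] [Module A L]
  [AddCommGroup K] [Module A K]

instance : IsScalarTower A (IsLocalRing.ResidueField A) (socle A L) :=
  (socle_isTorsionBySet A L).isScalarTower

theorem mem_socle_iff {x : L} :
    x ∈ socle A L ↔ IsLocalRing.maximalIdeal A ≤ Ideal.torsionOf A L x := by
  refine ⟨fun hx a ha => congrArg Subtype.val (@socle_isTorsionBySet A L _ _ _ _ ⟨x, hx⟩ ⟨a, ha⟩),
    fun hx => ?_⟩
  rcases eq_or_ne x 0 with rfl | hx0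
  · exact zero_mem _
  have heq : IsLocalRing.maximalIdeal A = Ideal.torsionOf A L x :=
    (IsLocalRing.maximalIdeal.isMaximal A).eq_of_le
      (mt (Ideal.torsionOf_eq_top_iff _ x).1 hx0) hx
  have hsimple : IsSimpleModule A (Submodule.span A {x}) :=
    isSimpleModule_iff_quot_maximal.2 ⟨Ideal.torsionOf A L x, heq ▸ inferInstance,
      ⟨(Ideal.quotTorsionOfEquivSpanSingleton A L x).symm⟩⟩
  exact le_sSup (a := Submodule.span A {x}) hsimple (Submodule.mem_span_singleton_self x)

theorem map_mem_socle (f : L →ₗ[A] K) {x : L} (hx : x ∈ socle A L) : f x ∈ socle A K := by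
  rw [mem_socle_iff] at hx ⊢
  intro a ha
  rw [Ideal.mem_torsionOf_iff, ← map_smul, (Ideal.mem_torsionOf_iff x a).1 (hx ha), map_zero]

/-- The map induced on socles by a linear map over a local ring, as a map of vector spaces over the
residue field. -/
noncomputable def socleMap (f : L →ₗ[A] K) : socle A L →ₗ[IsLocalRing.ResidueField A] socle A K :=
  (f.restrict fun _ => map_mem_socle f).extendScalarsOfSurjective IsLocalRing.residue_surjective

end Socle

section Primary

variable {R M : Type*} [CommRing R] [AddCommGroup M] [Module R M] {p q : Ideal R}
  {N J K : Submodule R M} {s : Finset (Submodule R M)}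

theorem IsPrimaryAt.mem_of_smul_mem (hJ : IsPrimaryAt p J) {r : R} {m : M} (hr : r ∉ p)
    (h : r • m ∈ J) : m ∈ J :=
  (hJ.1.mem_or_mem h).resolve_right (hJ.2 ▸ hr)

theorem isPrimaryAt_finsetInf (hne : s.Nonempty) (hs : ∀ J ∈ s, IsPrimaryAt p J) :
    IsPrimaryAt p (s.inf id) := by
  obtain ⟨J, hJ⟩ := hne
  have hrad : ∀ K ∈ s, (K.colon Set.univ).radical = (J.colon Set.univ).radical :=
    fun K hK => (hs K hK).2.trans (hs J hJ).2.symm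
  refine ⟨Submodule.isPrimary_finsetInf hJ (fun K hK => (hs K hK).1) hrad, ?_⟩
  rw [Submodule.colon_finsetInf,
    Ideal.radical_finset_inf (f := fun K => (id K).colon Set.univ) hJ hrad]
  exact (hs J hJ).2

theorem IsPrimaryAt.mem_associatedPrimes_inf (hJ : IsPrimaryAt p J) (hK : ¬ K ≤ J) :
    p ∈ (J ⊓ K).associatedPrimes := by
  obtain ⟨x, hxK, hxJ⟩ := SetLike.not_le_iff_exists.1 hK
  have hcolon : (J ⊓ K).colon {x} = J.colon {x} := by
    ext r
    simp only [Submodule.mem_colon_singleton, Submodule.mem_inf, K.smul_mem r hxK, and_true]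
  obtain ⟨hprim, rfl⟩ := hJ
  exact ⟨hprim.isPrime_radical_colon, x, by
    rw [hcolon, hprim.radical_colon_singleton_of_notMem hxJ]⟩

theorem exists_isPrimaryAt_of_mem_associatedPrimes (hs : ∀ J ∈ s, J.IsPrimary)
    (hp : p ∈ (s.inf id).associatedPrimes) : ∃ J ∈ s, IsPrimaryAt p J := by
  obtain ⟨hprime, x, hx⟩ := hp
  have hp_inf : p = s.inf fun J => (J.colon {x}).radical := by
    rw [hx, Submodule.colon_finsetInf, ← Ideal.radicalInfTopHom_apply, map_finset_inf]
    rfl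
  obtain ⟨J, hJ, hJp⟩ := Ideal.eq_inf_of_isPrime_inf (hp_inf ▸ hprime)
  rw [← hp_inf] at hJp
  have hxJ : x ∉ J := fun h => hprime.ne_top <| by
    rw [← hJp, Ideal.radical_eq_top, Submodule.colon_eq_top_iff_subset]
    exact Set.singleton_subset_iff.2 h
  exact ⟨J, hJ, hs J hJ, ((hs J hJ).radical_colon_singleton_of_notMem hxJ).symm.trans hJp⟩

theorem IsPrimaryAt.eq_of_mem_associatedPrimes (hJ : IsPrimaryAt p J)
    (hq : q ∈ J.associatedPrimes) : q = p := by
  obtain ⟨K, hK, hKq⟩ := exists_isPrimaryAt_of_mem_associatedPrimes (s := {J})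
    (fun K hK => Finset.mem_singleton.1 hK ▸ hJ.1) (by rwa [Finset.inf_singleton])
  rw [← hKq.2, Finset.mem_singleton.1 hK, hJ.2]

theorem exists_radical_colon_singleton_pow_le [IsNoetherian R M] (J : Submodule R M) (x : M) :
    ∃ n, (J.colon {x}).radical ^ n ≤ J.colon {x} := by
  -- The ring `R` need not be Noetherian, but `R ⧸ (J : x)` embeds into `M ⧸ J` and so is.
  set I := J.colon {x}
  let f : R →ₗ[R] M ⧸ J := J.mkQ ∘ₗ LinearMap.toSpanSingleton R M x
  have hker : LinearMap.ker f = I := by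
    ext r
    simp only [f, I, LinearMap.mem_ker, LinearMap.comp_apply, LinearMap.toSpanSingleton_apply,
      Submodule.mkQ_apply, Submodule.Quotient.mk_eq_zero, Submodule.mem_colon_singleton]
  have : IsNoetherian R (R ⧸ I) := isNoetherian_of_linearEquiv
    (f.quotKerEquivRange.symm.trans (Submodule.quotEquivOfEq _ _ hker))
  have : IsNoetherianRing (R ⧸ I) := isNoetherian_of_tower R this
  obtain ⟨n, hn⟩ := IsNoetherianRing.isNilpotent_nilradical (R ⧸ I)
  refine ⟨n, ?_⟩
  have hrad : I.radical.map (Ideal.Quotient.mk I) ≤ nilradical (R ⧸ I) := by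
    rw [Ideal.map_le_iff_le_comap, nilradical, Ideal.comap_radical]
    exact Ideal.radical_mono (by simp [← RingHom.ker_eq_comap_bot])
  have hbot : I.radical.map (Ideal.Quotient.mk I) ^ n = ⊥ :=
    le_bot_iff.1 ((Ideal.pow_right_mono hrad n).trans_eq hn)
  rwa [← Ideal.map_pow, Ideal.map_eq_bot_iff_le_ker, Ideal.mk_ker] at hbot

theorem IsPrimaryAt.exists_mem_notMem_le_colon_singleton [IsNoetherian R M]
    (hJ : IsPrimaryAt p J) (hK : ¬ K ≤ J) : ∃ m ∈ K, m ∉ J ∧ p ≤ J.colon {m} := by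
  classical
  obtain ⟨x, hxK, hxJ⟩ := SetLike.not_le_iff_exists.1 hK
  have hpow : ∃ n, p ^ n ≤ J.colon {x} := by
    rw [← hJ.2, ← hJ.1.radical_colon_singleton_of_notMem hxJ]
    exact exists_radical_colon_singleton_pow_le J x
  obtain ⟨n, hn⟩ : ∃ n, Nat.find hpow = n + 1 := Nat.exists_eq_succ_of_ne_zero fun h0 => by
    have h1 := h0 ▸ Nat.find_spec hpow
    rw [pow_zero, Ideal.one_eq_top, top_le_iff, Submodule.colon_eq_top_iff_subset] at h1
    exact hxJ (h1 rfl)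
  obtain ⟨a, ha, hax⟩ := SetLike.not_le_iff_exists.1 (Nat.find_min hpow (m := n) (by omega))
  rw [Submodule.mem_colon_singleton] at hax
  refine ⟨a • x, K.smul_mem a hxK, hax, fun r hr => ?_⟩
  rw [Submodule.mem_colon_singleton, smul_smul, ← Submodule.mem_colon_singleton, mul_comm]
  exact (hn ▸ Nat.find_spec hpow) (pow_succ p n ▸ Ideal.mul_mem_mul ha hr)

theorem exists_smul_sub_smul_mem_of_infIrred (hJ : InfIrred J) {m n : M} (hm : m ∉ J) (hn : n ∉ J) :
    ∃ a b : R, a • m - b • n ∈ J ∧ b • n ∉ J := by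
  have hinf : ¬ (J ⊔ Submodule.span R {m}) ⊓ (J ⊔ Submodule.span R {n}) ≤ J := fun hle => by
    rcases hJ.2 (le_antisymm hle (le_inf le_sup_left le_sup_left)) with h | h
    · exact hm (h ▸ Submodule.mem_sup_right (Submodule.mem_span_singleton_self m))
    · exact hn (h ▸ Submodule.mem_sup_right (Submodule.mem_span_singleton_self n))
  obtain ⟨z, ⟨hzm, hzn⟩, hz⟩ := SetLike.not_le_iff_exists.1 hinf
  obtain ⟨j, hj, _, hy, rfl⟩ := Submodule.mem_sup.1 hzm
  obtain ⟨a, rfl⟩ := Submodule.mem_span_singleton.1 hy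
  obtain ⟨k, hk, _, hy', hab⟩ := Submodule.mem_sup.1 hzn
  obtain ⟨b, rfl⟩ := Submodule.mem_span_singleton.1 hy'
  have hsub : a • m - b • n ∈ J := by
    have heq : a • m - b • n = k - j := by rw [sub_eq_sub_iff_add_eq_add, add_comm, ← hab]
    exact heq ▸ J.sub_mem hk hj
  exact ⟨a, b, hsub, fun h => hz (J.add_mem hj ((J.sub_mem_iff_left h).1 hsub))⟩

end Primary
section SocleAt

variable {R M : Type*} [CommRing R] [AddCommGroup M] [Module R M] (p : Ideal R) [p.IsPrime]
  {q : Ideal R} {N J K : Submodule R M} {s : Finset (Submodule R M)}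

/-- The socle of `(M ⧸ N)_p`, as an `R_p`-submodule. -/
abbrev socleAt (N : Submodule R M) :
    Submodule (Localization.AtPrime p) (LocalizedModule p.primeCompl (M ⧸ N)) :=
  socle (Localization.AtPrime p) (LocalizedModule p.primeCompl (M ⧸ N))

instance (N : Submodule R M) : Module.Free p.ResidueField (socleAt p N) :=
  Module.Free.of_divisionRing p.ResidueField (socleAt p N)

/-- The map `Soc (M ⧸ N)_p → Soc (M ⧸ J)_p` induced by the projection `M ⧸ N → M ⧸ J`. -/
noncomputable def socleFactor (h : N ≤ J) : socleAt p N →ₗ[p.ResidueField] socleAt p J :=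
  socleMap (LocalizedModule.map p.primeCompl (Submodule.factor h))

variable {p}

theorem mem_socleAt_iff {x : LocalizedModule p.primeCompl (M ⧸ N)} :
    x ∈ socleAt p N ↔ ∀ r ∈ p, r • x = 0 := by
  rw [mem_socle_iff, ← Localization.AtPrime.map_eq_maximalIdeal, Ideal.map_le_iff_le_comap]
  refine forall₂_congr fun r _ => ?_
  rw [Ideal.mem_comap, Ideal.mem_torsionOf_iff, algebraMap_smul]

theorem mk_mkQ_eq_zero_iff {m : M} {t : p.primeCompl} :
    LocalizedModule.mk (N.mkQ m) t = 0 ↔ ∃ u ∉ p, u • m ∈ N := by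
  rw [← LocalizedModule.zero_mk 1, LocalizedModule.mk_eq]
  simp only [one_smul, smul_zero, Submonoid.smul_def, Submodule.mkQ_apply,
    ← Submodule.Quotient.mk_smul, Submodule.Quotient.mk_eq_zero]
  exact ⟨fun ⟨u, h⟩ => ⟨u, u.2, h⟩, fun ⟨u, hu, h⟩ => ⟨⟨u, hu⟩, h⟩⟩

theorem IsPrimaryAt.mk_mkQ_eq_zero_iff (hJ : IsPrimaryAt p J) {m : M} {t : p.primeCompl} :
    LocalizedModule.mk (J.mkQ m) t = 0 ↔ m ∈ J := by
  rw [IndexOfReducibility.mk_mkQ_eq_zero_iff]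
  exact ⟨fun ⟨u, hu, h⟩ => hJ.mem_of_smul_mem hu h,
    fun h => ⟨1, p.primeCompl.one_mem, J.smul_mem 1 h⟩⟩

/-- The class of `m / 1` in `Soc (M ⧸ N)_p`, for `m` with `p • m ⊆ N`. -/
def socleMk (m : M) (h : p ≤ N.colon {m}) : socleAt p N :=
  ⟨LocalizedModule.mk (N.mkQ m) 1, mem_socleAt_iff.2 fun r hr => by
    rw [LocalizedModule.smul'_mk, ← map_smul, Submodule.mkQ_apply,
      (Submodule.Quotient.mk_eq_zero N).2 (Submodule.mem_colon_singleton.1 (h hr)),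
      LocalizedModule.zero_mk]⟩

theorem IsPrimaryAt.socleMk_eq_zero_iff (hJ : IsPrimaryAt p J) {m : M} (h : p ≤ J.colon {m}) :
    socleMk m h = 0 ↔ m ∈ J :=
  Subtype.ext_iff.trans hJ.mk_mkQ_eq_zero_iff

theorem socleMk_eq_zero {m : M} (hm : m ∈ N) (h : p ≤ N.colon {m}) : socleMk m h = 0 :=
  Subtype.ext (mk_mkQ_eq_zero_iff.2 ⟨1, p.primeCompl.one_mem, N.smul_mem 1 hm⟩)

theorem coe_socleFactor_mk (h : N ≤ J) {m : M} {t : p.primeCompl}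
    (hm : LocalizedModule.mk (N.mkQ m) t ∈ socleAt p N) :
    (socleFactor p h ⟨_, hm⟩ : LocalizedModule p.primeCompl (M ⧸ J)) =
      LocalizedModule.mk (J.mkQ m) t :=
  LocalizedModule.map_mk ..

theorem socleFactor_socleMk (h : N ≤ J) {m : M} (hm : p ≤ N.colon {m}) :
    socleFactor p h (socleMk m hm) =
      socleMk m (hm.trans (Submodule.colon_mono h subset_rfl)) :=
  Subtype.ext (coe_socleFactor_mk h _)

theorem socleFactor_socleFactor (h : N ≤ J) (h' : J ≤ K) (x : socleAt p N) :
    socleFactor p h' (socleFactor p h x) = socleFactor p (h.trans h') x := by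
  obtain ⟨x, hx⟩ := x
  induction x using LocalizedModule.induction_on with
  | _ m t =>
  obtain ⟨m, rfl⟩ := N.mkQ_surjective m
  have hJ : socleFactor p h ⟨_, hx⟩ =
      ⟨LocalizedModule.mk (J.mkQ m) t, coe_socleFactor_mk h hx ▸ (socleFactor p h ⟨_, hx⟩).2⟩ :=
    Subtype.ext (coe_socleFactor_mk h hx)
  refine Subtype.ext ?_
  rw [hJ, coe_socleFactor_mk, coe_socleFactor_mk]

theorem subsingleton_socleAt (hJ : IsPrimaryAt q J) (hq : q ≠ p) :
    Subsingleton (socleAt p J) := by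
  refine subsingleton_of_forall_eq 0 fun ⟨x, hx⟩ => Subtype.ext ?_
  induction x using LocalizedModule.induction_on with
  | _ m t =>
  obtain ⟨m, rfl⟩ := J.mkQ_surjective m
  change LocalizedModule.mk (J.mkQ m) t = 0
  rw [mk_mkQ_eq_zero_iff]
  -- An element of `q` outside `p` acts on `(M ⧸ J)_p` both invertibly and locally nilpotently;
  -- an element of `p` outside `q` acts injectively but kills the socle.
  by_cases hpq : p ≤ q
  · obtain ⟨a, haq, hap⟩ := SetLike.not_le_iff_exists.1 fun hqp => hq (le_antisymm hqp hpq)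
    obtain ⟨n, hn⟩ : a ∈ (J.colon Set.univ).radical := hJ.2 ▸ haq
    exact ⟨a ^ n, fun h => hap (Ideal.IsPrime.mem_of_pow_mem ‹_› n h),
      Submodule.mem_colon.1 hn m (Set.mem_univ m)⟩
  · obtain ⟨r, hrp, hrq⟩ := SetLike.not_le_iff_exists.1 hpq
    have hrm := mem_socleAt_iff.1 hx r hrp
    rw [LocalizedModule.smul'_mk, ← map_smul, mk_mkQ_eq_zero_iff] at hrm
    obtain ⟨u, hu, hum⟩ := hrm
    exact ⟨u, hu, hJ.mem_of_smul_mem hrq (smul_comm u r m ▸ hum)⟩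

theorem eq_zero_of_forall_socleFactor_eq_zero (hs : s.inf id = N) (hprim : ∀ J ∈ s, J.IsPrimary)
    {x : socleAt p N}
    (hx : ∀ J ∈ s, IsPrimaryAt p J → ∀ h : N ≤ J, socleFactor p h x = 0) : x = 0 := by
  have hle (J) (hJ : J ∈ s) : N ≤ J := hs ▸ Finset.inf_le (f := id) hJ
  have hx0 (J) (hJ : J ∈ s) : socleFactor p (hle J hJ) x = 0 := by
    by_cases hp : IsPrimaryAt p J
    · exact hx J hJ hp _
    · have := subsingleton_socleAt (p := p) ⟨hprim J hJ, rfl⟩ fun h => hp ⟨hprim J hJ, h⟩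
      exact Subsingleton.elim _ _
  obtain ⟨x, hxN⟩ := x
  induction x using LocalizedModule.induction_on with
  | _ m t =>
  obtain ⟨m, rfl⟩ := N.mkQ_surjective m
  have hu (J : s) : ∃ u ∉ p, u • m ∈ (J : Submodule R M) := mk_mkQ_eq_zero_iff.1 <|
    (coe_socleFactor_mk (hle J J.2) hxN).symm.trans (congrArg Subtype.val (hx0 J J.2))
  choose u hup hum using hu
  refine Subtype.ext (mk_mkQ_eq_zero_iff.2
    ⟨∏ J, u J, p.primeCompl.prod_mem fun J _ => hup J, ?_⟩)
  rw [← hs, Submodule.mem_finsetInf]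
  intro J hJ
  rw [← Finset.prod_erase_mul _ _ (Finset.mem_univ (⟨J, hJ⟩ : s)), mul_smul]
  exact J.smul_mem _ (hum ⟨J, hJ⟩)

theorem IsPrimaryAt.exists_smul_socleMk_eq (hJ : IsPrimaryAt p J) (hirr : InfIrred J) {m : M}
    (hm : m ∉ J) (h : p ≤ J.colon {m}) (x : socleAt p J) :
    ∃ c : p.ResidueField, c • socleMk m h = x := by
  obtain ⟨x, hx⟩ := x
  induction x using LocalizedModule.induction_on with
  | _ n t =>
  obtain ⟨n, rfl⟩ := J.mkQ_surjective n
  by_cases hn : n ∈ J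
  · exact ⟨0, (zero_smul _ _).trans (Subtype.ext (hJ.mk_mkQ_eq_zero_iff.2 hn).symm)⟩
  obtain ⟨a, b, hsub, hbn⟩ := exists_smul_sub_smul_mem_of_infIrred hirr hm hn
  have hb : b ∉ p := fun hb => hbn <| by
    have hbx := mem_socleAt_iff.1 hx b hb
    rwa [LocalizedModule.smul'_mk, ← map_smul, hJ.mk_mkQ_eq_zero_iff] at hbx
  refine ⟨IsLocalRing.residue _ (Localization.mk a (⟨b, hb⟩ * t)), Subtype.ext ?_⟩
  calc Localization.mk a (⟨b, hb⟩ * t) • LocalizedModule.mk (J.mkQ m) 1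
      = LocalizedModule.mk (b • J.mkQ n) (⟨b, hb⟩ * t) := by
        rw [LocalizedModule.mk_smul_mk, mul_one, ← map_smul, ← map_smul]
        exact congrArg (LocalizedModule.mk · _) ((Submodule.Quotient.eq J).2 hsub)
    _ = LocalizedModule.mk (J.mkQ n) t := LocalizedModule.mk_cancel_common_left ⟨b, hb⟩ t _

section Noetherian

variable [IsNoetherian R M]

theorem IsPrimaryAt.rank_socleAt_eq_one (hJ : IsPrimaryAt p J) (hirr : InfIrred J) :
    Module.rank p.ResidueField (socleAt p J) = 1 := by
  obtain ⟨m, -, hm, hpm⟩ :=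
    hJ.exists_mem_notMem_le_colon_singleton (K := ⊤) (mt top_le_iff.1 hJ.1.ne_top)
  exact rank_eq_one_iff.2 ⟨socleMk m hpm, mt (hJ.socleMk_eq_zero_iff hpm).1 hm,
    hJ.exists_smul_socleMk_eq hirr hm hpm⟩

theorem IsPrimaryAt.eq_of_socleFactor_injective (hJ : IsPrimaryAt p J) (h : J ≤ K)
    (hinj : Function.Injective (socleFactor p h)) : J = K := by
  refine le_antisymm h (not_not.1 fun hKJ => ?_)
  obtain ⟨m, hmK, hmJ, hpm⟩ := hJ.exists_mem_notMem_le_colon_singleton hKJ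
  refine hmJ ((hJ.socleMk_eq_zero_iff hpm).1 (hinj ?_))
  rw [socleFactor_socleMk, socleMk_eq_zero hmK, map_zero]

theorem IsPrimaryAt.exists_socleFactor_eq (hJ : IsPrimaryAt p J) (hirr : InfIrred J)
    (hN : J ⊓ K = N) (hK : ¬ K ≤ J) (y : socleAt p J) :
    ∃ x : socleAt p N, (∀ h : N ≤ J, socleFactor p h x = y) ∧
      ∀ (L : Submodule R M) (h : N ≤ L), K ≤ L → socleFactor p h x = 0 := by
  obtain ⟨m, hmK, hmJ, hpm⟩ := hJ.exists_mem_notMem_le_colon_singleton hK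
  have hpN : p ≤ N.colon {m} := fun r hr => Submodule.mem_colon_singleton.2 <|
    hN ▸ ⟨Submodule.mem_colon_singleton.1 (hpm hr), K.smul_mem r hmK⟩
  obtain ⟨c, rfl⟩ := hJ.exists_smul_socleMk_eq hirr hmJ hpm y
  refine ⟨c • socleMk m hpN, fun h => ?_, fun L h hKL => ?_⟩
  · rw [map_smul, socleFactor_socleMk]
  · rw [map_smul, socleFactor_socleMk, socleMk_eq_zero (hKL hmK), smul_zero]

end Noetherian

end SocleAt

section Decomposition

variable {R M : Type*} [CommRing R] [AddCommGroup M] [Module R M] {p : Ideal R}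
  {N J Q : Submodule R M} {s t : Finset (Submodule R M)}

open Classical in
/-- The `p`-primary members of a finite set of submodules. -/
noncomputable def primaryPart (p : Ideal R) (s : Finset (Submodule R M)) :
    Finset (Submodule R M) :=
  {J ∈ s | IsPrimaryAt p J}

theorem mem_primaryPart : J ∈ primaryPart p s ↔ J ∈ s ∧ IsPrimaryAt p J := by
  classical exact Finset.mem_filter

theorem primaryPart_subset : primaryPart p s ⊆ s :=
  fun _ hJ => (mem_primaryPart.1 hJ).1

theorem primaryPart_eq_self (hs : ∀ J ∈ s, IsPrimaryAt p J) : primaryPart p s = s :=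
  primaryPart_subset.antisymm fun J hJ => mem_primaryPart.2 ⟨hJ, hs J hJ⟩

theorem card_primaryPart : (primaryPart p s).card = countAt p s := by
  rw [countAt, ← Set.ncard_coe_finset]
  congr 1
  ext J
  exact mem_primaryPart

theorem inf_inf_erase (hJ : J ∈ s) : J ⊓ (s.erase J).inf id = s.inf id := by
  rw [← id_eq J, ← Finset.inf_insert, id_eq, Finset.insert_erase hJ]

namespace IsIrredundantIrreducibleDecomposition

theorem le (hs : IsIrredundantIrreducibleDecomposition N s) (hJ : J ∈ s) : N ≤ J :=
  hs.inf_eq ▸ Finset.inf_le (f := id) hJ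

theorem le_inf_primaryPart (hs : IsIrredundantIrreducibleDecomposition N s) :
    N ≤ (primaryPart p s).inf id :=
  hs.inf_eq ▸ Finset.inf_mono primaryPart_subset

theorem inf_inf_erase_eq (hs : IsIrredundantIrreducibleDecomposition N s) (hJ : J ∈ s) :
    J ⊓ (s.erase J).inf id = N :=
  (inf_inf_erase hJ).trans hs.inf_eq

theorem eq_of_subset (hs : IsIrredundantIrreducibleDecomposition N s) (hts : t ⊆ s)
    (ht : t.inf id ≤ N) : t = s := by
  refine hts.antisymm fun J hJ => not_not.1 fun hJt => hs.irredundant hJ ?_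
  exact (Finset.inf_mono (Finset.subset_erase.2 ⟨hts, hJt⟩)).trans (ht.trans (hs.le hJ))

theorem inf_primaryPart (hs : IsIrredundantIrreducibleDecomposition N s) :
    IsIrredundantIrreducibleDecomposition ((primaryPart p s).inf id) (primaryPart p s) where
  inf_eq := rfl
  irreducible _ hJ := hs.irreducible (primaryPart_subset hJ)
  irredundant _ hJ hle := hs.irredundant (primaryPart_subset hJ)
    ((Finset.inf_mono (Finset.erase_subset_erase _ primaryPart_subset)).trans hle)

theorem mem_associatedPrimes (hs : IsIrredundantIrreducibleDecomposition N s) (hJ : J ∈ s)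
    (hJp : IsPrimaryAt p J) : p ∈ N.associatedPrimes :=
  hs.inf_inf_erase_eq hJ ▸ hJp.mem_associatedPrimes_inf (hs.irredundant hJ)

theorem isPrimaryAt [IsNoetherian R M] (hs : IsIrredundantIrreducibleDecomposition Q s)
    (hQ : IsPrimaryAt p Q) (hJ : J ∈ s) : IsPrimaryAt p J :=
  have hJprim := (hs.irreducible hJ).isPrimary
  ⟨hJprim, hQ.eq_of_mem_associatedPrimes (hs.mem_associatedPrimes hJ ⟨hJprim, rfl⟩)⟩

end IsIrredundantIrreducibleDecomposition

end Decomposition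

section Count

variable {R M : Type*} [CommRing R] [AddCommGroup M] [Module R M] (p : Ideal R) [p.IsPrime]
  {N : Submodule R M} {s : Finset (Submodule R M)}

/-- The map from `Soc (M ⧸ N)_p` to the product of the `Soc (M ⧸ J)_p`, where `J` runs over a
finite set of submodules containing `N`. -/
noncomputable def socleToPi (h : N ≤ s.inf id) :
    socleAt p N →ₗ[p.ResidueField] (J : s) → socleAt p (J : Submodule R M) :=
  LinearMap.pi fun J => socleFactor p (h.trans (Finset.inf_le (f := id) J.2))

variable {p}

namespace IsIrredundantIrreducibleDecomposition

variable [IsNoetherian R M]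

theorem socleToPi_injective (hs : IsIrredundantIrreducibleDecomposition N s) :
    Function.Injective (socleToPi p (hs.le_inf_primaryPart (p := p))) :=
  (injective_iff_map_eq_zero _).2 fun _ hx =>
    eq_zero_of_forall_socleFactor_eq_zero hs.inf_eq (fun _ hJ => (hs.irreducible hJ).isPrimary)
      fun J hJ hJp _ => congrFun hx ⟨J, mem_primaryPart.2 ⟨hJ, hJp⟩⟩

theorem socleToPi_surjective (hs : IsIrredundantIrreducibleDecomposition N s) :
    Function.Surjective (socleToPi p (hs.le_inf_primaryPart (p := p))) := by
  classical
  rw [← LinearMap.range_eq_top, eq_top_iff,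
    ← LinearMap.iSup_range_single p.ResidueField fun J : primaryPart p s => socleAt p J.1,
    iSup_le_iff]
  rintro ⟨J, hJ⟩ _ ⟨y, rfl⟩
  obtain ⟨hJs, hJp⟩ := mem_primaryPart.1 hJ
  obtain ⟨x, hxJ, hx0⟩ := hJp.exists_socleFactor_eq (hs.irreducible hJs)
    (hs.inf_inf_erase_eq hJs) (hs.irredundant hJs) y
  refine ⟨x, funext fun L => ?_⟩
  rw [LinearMap.single_apply]
  by_cases hLJ : L = ⟨J, hJ⟩
  · subst hLJ
    rw [Pi.single_eq_same]
    exact hxJ _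
  · rw [Pi.single_eq_of_ne hLJ]
    exact hx0 L _ (Finset.inf_le (f := id)
      (Finset.mem_erase.2 ⟨fun h => hLJ (Subtype.ext h), primaryPart_subset L.2⟩))

theorem socleFactor_inf_primaryPart_surjective (hs : IsIrredundantIrreducibleDecomposition N s) :
    Function.Surjective (socleFactor p (hs.le_inf_primaryPart (p := p))) := fun y => by
  obtain ⟨x, hx⟩ := hs.socleToPi_surjective (socleToPi p le_rfl y)
  refine ⟨x, sub_eq_zero.1 <| eq_zero_of_forall_socleFactor_eq_zero rfl
    (fun J hJ => (mem_primaryPart.1 hJ).2.1) fun J hJ _ h => ?_⟩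
  rw [map_sub, sub_eq_zero, socleFactor_socleFactor]
  exact congrFun hx ⟨J, hJ⟩

theorem countAt_eq_rank (hs : IsIrredundantIrreducibleDecomposition N s) :
    (countAt p s : Cardinal) = Module.rank p.ResidueField (socleAt p N) := by
  have hone (J : primaryPart p s) : Module.rank p.ResidueField (socleAt p J.1) = 1 :=
    (mem_primaryPart.1 J.2).2.rank_socleAt_eq_one (hs.irreducible (primaryPart_subset J.2))
  rw [(LinearEquiv.ofBijective _ ⟨hs.socleToPi_injective, hs.socleToPi_surjective⟩).rank_eq,
    rank_pi, ← card_primaryPart]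
  simp only [hone, Cardinal.sum_const, Cardinal.mk_coe_finset, Cardinal.lift_natCast,
    Cardinal.lift_one, mul_one]

theorem countAt_eq_irAt (hs : IsIrredundantIrreducibleDecomposition N s) :
    countAt p s = irAt p N := by
  obtain ⟨t, ht, hcount⟩ := Nat.sInf_mem
    (s := {n | ∃ s, IsIrredundantIrreducibleDecomposition N s ∧ countAt p s = n}) ⟨_, s, hs, rfl⟩
  rw [irAt, ← hcount]
  exact_mod_cast hs.countAt_eq_rank.trans ht.countAt_eq_rank.symm

end IsIrredundantIrreducibleDecomposition

theorem irAt_eq_rank [IsNoetherian R M] (N : Submodule R M) :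
    (irAt p N : Cardinal) = Module.rank p.ResidueField (socleAt p N) := by
  obtain ⟨s, hs⟩ := exists_isIrredundantIrreducibleDecomposition N
  rw [← hs.countAt_eq_irAt, hs.countAt_eq_rank]

end Count

section Components

variable {R M : Type*} [CommRing R] [AddCommGroup M] [Module R M] {p : Ideal R}
  {N K Q : Submodule R M} {s : Finset (Submodule R M)}

theorem not_isPrimaryAt_of_mem_erase {t : Finset (Submodule R M)}
    (ht : N.IsMinimalPrimaryDecomposition t) (hQ : Q ∈ t) (hQp : IsPrimaryAt p Q)
    (hK : K ∈ t.erase Q) : ¬ IsPrimaryAt p K := fun hKp =>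
  ht.distinct (Finset.mem_of_mem_erase hK) hQ (Finset.ne_of_mem_erase hK)
    (hKp.2.trans hQp.2.symm)

theorem mem_primaryComponents_of_inf_eq [IsNoetherian R M] (hQ : IsPrimaryAt p Q)
    (hN : Q ⊓ K = N) (hKQ : ¬ K ≤ Q) (hpK : p ∉ K.associatedPrimes) :
    Q ∈ primaryComponents p N := by
  classical
  obtain ⟨u, hu⟩ := Submodule.IsLasker.exists_isMinimalPrimaryDecomposition
    (Submodule.isLasker R M) K
  have hup (J) (hJ : J ∈ u) : (J.colon Set.univ).radical ≠ p := fun h =>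
    hpK (h ▸ hu.mem_associatedPrimes hJ)
  obtain ⟨t, htu, htN, htmin⟩ := Submodule.decomposition_erase_inf (s := insert Q u) (N := N)
    (by rw [Finset.inf_insert, hu.inf_eq, id_eq, hN])
  have hQt : Q ∈ t := not_not.1 fun hQt => hKQ <| by
    rw [← hu.inf_eq]
    refine (Finset.inf_mono ((Finset.subset_insert_iff_of_notMem hQt).1 htu)).trans ?_
    exact htN.trans_le (hN ▸ inf_le_left)
  refine ⟨hQ, t, ⟨htN, fun J hJ => ?_, ?_, htmin⟩, hQt⟩
  · rcases Finset.mem_insert.1 (htu hJ) with rfl | hJu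
    exacts [hQ.1, hu.primary hJu]
  · refine Set.Pairwise.mono (Finset.coe_subset.2 htu) ?_
    rw [Finset.coe_insert, Set.pairwise_insert]
    exact ⟨hu.distinct, fun J hJ _ => ⟨fun h => hup J hJ (h.symm.trans hQ.2),
      fun h => hup J hJ (h.trans hQ.2)⟩⟩

theorem mem_primaryComponents_iff [IsNoetherian R M] :
    Q ∈ primaryComponents p N ↔
      IsPrimaryAt p Q ∧ ∃ K, Q ⊓ K = N ∧ ¬ K ≤ Q ∧ p ∉ K.associatedPrimes := by
  refine ⟨fun ⟨hQ, t, ht, hQt⟩ => ⟨hQ, (t.erase Q).inf id, (inf_inf_erase hQt).trans ht.inf_eq,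
    ht.minimal hQt, fun hp => ?_⟩,
    fun ⟨hQ, K, hN, hKQ, hpK⟩ => mem_primaryComponents_of_inf_eq hQ hN hKQ hpK⟩
  obtain ⟨J, hJ, hJp⟩ := exists_isPrimaryAt_of_mem_associatedPrimes
    (fun J hJ => ht.primary (Finset.mem_of_mem_erase hJ)) hp
  exact not_isPrimaryAt_of_mem_erase ht hQt hQ hJ hJp

theorem socleFactor_injective_of_mem_primaryComponents [p.IsPrime]
    (hQ : Q ∈ primaryComponents p N) (hNQ : N ≤ Q) : Function.Injective (socleFactor p hNQ) := by
  obtain ⟨hQp, t, ht, hQt⟩ := hQ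
  refine (injective_iff_map_eq_zero _).2 fun x hx =>
    eq_zero_of_forall_socleFactor_eq_zero ht.inf_eq ht.primary fun J hJ hJp _ => ?_
  obtain rfl : J = Q := not_not.1 fun hne =>
    not_isPrimaryAt_of_mem_erase ht hQt hQp (Finset.mem_erase.2 ⟨hne, hJ⟩) hJp
  exact hx

variable [IsNoetherian R M]

theorem IsIrredundantIrreducibleDecomposition.inf_primaryPart_mem_primaryComponents
    (hs : IsIrredundantIrreducibleDecomposition N s) (hne : (primaryPart p s).Nonempty) :
    (primaryPart p s).inf id ∈ primaryComponents p N := by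
  classical
  refine mem_primaryComponents_of_inf_eq (K := (s \ primaryPart p s).inf id)
    (isPrimaryAt_finsetInf hne fun J hJ => (mem_primaryPart.1 hJ).2) ?_ (fun hle => ?_) fun hp => ?_
  · rw [← Finset.inf_union, Finset.union_sdiff_of_subset primaryPart_subset, hs.inf_eq]
  · obtain ⟨J, hJ⟩ := hne
    refine hs.irredundant (primaryPart_subset hJ) (le_trans (Finset.inf_mono ?_)
      (hle.trans (Finset.inf_le (f := id) hJ)))
    exact Finset.subset_erase.2 ⟨Finset.sdiff_subset, fun h => (Finset.mem_sdiff.1 h).2 hJ⟩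
  · obtain ⟨J, hJ, hJp⟩ := exists_isPrimaryAt_of_mem_associatedPrimes
      (fun J hJ => (hs.irreducible (Finset.sdiff_subset hJ)).isPrimary) hp
    exact (Finset.mem_sdiff.1 hJ).2 (mem_primaryPart.2 ⟨Finset.sdiff_subset hJ, hJp⟩)

theorem IsIrredundantIrreducibleDecomposition.isMaximalComponent_inf_primaryPart [p.IsPrime]
    (hs : IsIrredundantIrreducibleDecomposition N s) (hne : (primaryPart p s).Nonempty) :
    IsMaximalComponent p N ((primaryPart p s).inf id) := by
  have hmem := hs.inf_primaryPart_mem_primaryComponents hne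
  refine ⟨hmem, fun Q' hQ' hle => (hmem.1.eq_of_socleFactor_injective hle ?_).ge⟩
  have hNQ' := socleFactor_injective_of_mem_primaryComponents hQ'
    (hs.le_inf_primaryPart.trans hle)
  refine Function.Injective.of_comp_right (g := socleFactor p hs.le_inf_primaryPart) ?_
    hs.socleFactor_inf_primaryPart_surjective
  convert hNQ' using 1
  exact funext (socleFactor_socleFactor _ _)

namespace IsMaximalComponent

theorem exists_primaryPart_eq (hQ : IsMaximalComponent p N Q)
    (hs : IsIrredundantIrreducibleDecomposition Q s) :
    ∃ w, IsIrredundantIrreducibleDecomposition N w ∧ primaryPart p w = s := by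
  classical
  obtain ⟨hQp, K, hN, hKQ, hpK⟩ := mem_primaryComponents_iff.1 hQ.1
  obtain ⟨u, hu⟩ := exists_isIrredundantIrreducibleDecomposition K
  obtain ⟨w, hwsu, hwN, hwirr⟩ := Submodule.decomposition_erase_inf (s := s ∪ u) (N := N)
    (by rw [Finset.inf_union, hs.inf_eq, hu.inf_eq, hN])
  have hw : IsIrredundantIrreducibleDecomposition N w :=
    ⟨hwN, fun J hJ => (Finset.mem_union.1 (hwsu hJ)).elim (hs.irreducible ·) (hu.irreducible ·),
      hwirr⟩
  have hsub : primaryPart p w ⊆ s := fun J hJ => by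
    obtain ⟨hJw, hJp⟩ := mem_primaryPart.1 hJ
    exact (Finset.mem_union.1 (hwsu hJw)).resolve_right fun hJu =>
      hpK (hu.mem_associatedPrimes hJu hJp)
  have hne : (primaryPart p w).Nonempty := by
    obtain ⟨J, hJ, hJp⟩ := exists_isPrimaryAt_of_mem_associatedPrimes (p := p)
      (fun J hJ => (hw.irreducible hJ).isPrimary)
      (hw.inf_eq ▸ hN ▸ hQp.mem_associatedPrimes_inf hKQ)
    exact ⟨J, mem_primaryPart.2 ⟨hJ, hJp⟩⟩
  exact ⟨w, hw, hs.eq_of_subset hsub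
    (hQ.2 (hw.inf_primaryPart_mem_primaryComponents hne) (hs.inf_eq ▸ Finset.inf_mono hsub))⟩

theorem irAt_eq [p.IsPrime] (hQ : IsMaximalComponent p N Q) : irAt p N = irAt p Q := by
  obtain ⟨s, hs⟩ := exists_isIrredundantIrreducibleDecomposition Q
  obtain ⟨w, hw, hws⟩ := hQ.exists_primaryPart_eq hs
  rw [← hs.countAt_eq_irAt, ← hw.countAt_eq_irAt, ← card_primaryPart, ← card_primaryPart, hws,
    primaryPart_eq_self fun _ hJ => hs.isPrimaryAt hQ.1.1 hJ]

end IsMaximalComponent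

theorem irreducibleComponents_eq_iUnion [p.IsPrime] (N : Submodule R M) :
    irreducibleComponents p N =
      ⋃ Q ∈ {Q | IsMaximalComponent p N Q}, irreducibleComponents p Q := by
  ext J
  simp only [Set.mem_iUnion, Set.mem_ofPred_eq, exists_prop]
  constructor
  · rintro ⟨hJp, s, hs, hJs⟩
    have hJ : J ∈ primaryPart p s := mem_primaryPart.2 ⟨hJs, hJp⟩
    exact ⟨_, hs.isMaximalComponent_inf_primaryPart ⟨J, hJ⟩, hJp, _, hs.inf_primaryPart, hJ⟩
  · rintro ⟨Q, hQ, hJp, s, hs, hJs⟩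
    obtain ⟨w, hw, rfl⟩ := hQ.exists_primaryPart_eq hs
    exact ⟨hJp, w, hw, primaryPart_subset hJs⟩

end Components

theorem corollary3p4_general {R M : Type*} [CommRing R] [AddCommGroup M] [Module R M]
    [IsNoetherian R M] (N : Submodule R M) (p : Ideal R) [p.IsPrime] :
    (∀ s, IsIrredundantIrreducibleDecomposition N s → countAt p s = irAt p N) ∧
    (∀ Q, IsMaximalComponent p N Q →
      ∀ s, IsIrredundantIrreducibleDecomposition Q s → countAt p s = irAt p Q) ∧
    (∀ Q, IsMaximalComponent p N Q →
      irAt p N = irAt p Q ∧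
      (irAt p Q : Cardinal) = Module.rank p.ResidueField (socleAt p N)) ∧
    irreducibleComponents p N =
      ⋃ Q ∈ {Q | IsMaximalComponent p N Q}, irreducibleComponents p Q :=
  ⟨fun _ hs => hs.countAt_eq_irAt, fun _ _ _ hs => hs.countAt_eq_irAt,
    fun _ hQ => ⟨hQ.irAt_eq, hQ.irAt_eq ▸ irAt_eq_rank N⟩, irreducibleComponents_eq_iUnion N⟩

end IndexOfReducibility

open IndexOfReducibility in
theorem corollary3p4 {R M : Type*} [CommRing R] [IsNoetherianRing R]
    [AddCommGroup M] [Module R M] [Module.Finite R M]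
    (N : Submodule R M) (p : Ideal R) [p.IsPrime] (hp : IsEmbeddedPrime N p) :
    -- `ir_p` is well defined for `N` and for every `p`-maximal embedded component of `N`
    (∀ s, IsIrredundantIrreducibleDecomposition N s → countAt p s = irAt p N) ∧
    (∀ Q, IsMaximalComponent p N Q →
      ∀ s, IsIrredundantIrreducibleDecomposition Q s → countAt p s = irAt p Q) ∧
    -- (i)
    (∀ Q, IsMaximalComponent p N Q →
      irAt p N = irAt p Q ∧
      (irAt p Q : Cardinal) = Module.rank p.ResidueField
        (socle (Localization.AtPrime p) (LocalizedModule p.primeCompl (M ⧸ N)))) ∧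
    -- (ii)
    irreducibleComponents p N =
      ⋃ Q ∈ {Q | IsMaximalComponent p N Q}, irreducibleComponents p Q :=
  corollary3p4_general N p
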